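/- Let $\alpha\in(0,1)\cup(1,2)$ and $\mathbb{R}^+=(0,\infty)$. For $\beta>0$ put $({}_{\mathcal H}\mathcal I_-^{\beta}f)(x)=\frac1{\Gamma(\beta)}\int_x^\infty(\log\frac zx)^{\beta-1}f(z)\frac{dz}z$, and for $\beta\in(0,1)$ put $({}_{\mathcal H}\mathcal D_-^{\beta}f)(x)=-x\frac{d}{dx}({}_{\mathcal H}\mathcal I_-^{1-\beta}f)(x)$, for $x>0$. Let $K_\alpha=\Gamma(\frac{\alpha+1}2)/\sqrt{\Gamma(\alpha)}$ and let $$\mathcal M^\alpha_- f=\begin{cases}K_\alpha\,{}_{\mathcal H}\mathcal D_-^{(1-\alpha)/2}f,&\alpha\in(0,1),\\ K_\alpha\,{}_{\mathcal H}\mathcal I_-^{(\alpha-1)/2}f,&\alpha\in(1,2),\end{cases}\qquad \overline{\mathcal M}{}^\alpha_- f=\begin{cases}{}_{\mathcal H}\mathcal I_-^{(1-\alpha)/2}f,&\alpha\in(0,1),\\ {}_{\mathcal H}\mathcal D_-^{(\alpha-1)/2}f,&\alpha\in(1,2).\end{cases}$$ Let $B=\{B(t)\}_{t\ge0}$ be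 a standard Brownian motion, and for $g\in L_2(\mathbb{R}^+)$ let $\int_0^\infty g\,dB$ be the Wiener integral of $g$. Let $B^{\mathcal H}_\alpha$ be the Hadamard fractional Brownian motion driven by $B$, that is, $B^{\mathcal H}_\alpha(t)=\int_0^\infty(\mathcal M^\alpha_-1_{[0,t)})(s)\,dB(s)$ almost surely for each $t\ge0$. For $f$ with $\mathcal M^\alpha_-f\in L_2(\mathbb{R}^+)$ let $\int_0^\infty f\,dB^{\mathcal H}_\alpha=\int_0^\infty(\mathcal M^\alpha_-f)(s)\,dB(s)$, which is also the limit in $L_2(\Omega)$ of $\int_0^\infty f_n\,dB^{\mathcal H}_\alpha$ for step functions $f_n$ such that $\|\mathcal M^\alpha_-(f-f_n)\|_{L_2(\mathbb{R}^+)}\to0$, where $\int_0^\infty\sum_k a_k1_{[u_k,v_k)}\,dB^{\mathcal H}_\alpha=\sum_ka_k(B^{\mathcal H}_\alpha(v_k)-B^{\mathcal H}_\alpha(u_k))$; put $\int_0^tf\,dB^{\mathcal H}_\alpha=\int_0^\infty 1_{[0,t)}f\,dB^{\mathcal H}_\alpha$. Then for every $t\ge0$ the function $\overline{\mathcal M}{}^\alpha_-1_{[0,t)}$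 is defined almost everywhere on $\mathbb{R}^+$ and belongs to $L_2(\mathbb{R}^+)$, the two integrals with respect to $B^{\mathcal H}_\alpha$ below exist in the above sense (in particular, approximating step functions exist for both integrands), and almost surely $$B(t)=\frac{\sqrt{\Gamma(\alpha)}}{\Gamma(\frac{\alpha+1}2)}\int_0^\infty\bigl(\overline{\mathcal M}{}^\alpha_-1_{[0,t)}\bigr)(s)\,dB^{\mathcal H}_\alpha(s) =\frac{\sqrt{\Gamma(\alpha)}}{\Gamma(\frac{\alpha+1}2)\,\Gamma(\frac{3-\alpha}2)}\int_0^t\Bigl(\log\frac ts\Bigr)^{(1-\alpha)/2}dB^{\mathcal H}_\alpha(s).$$ -/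

import Mathlib

open MeasureTheory ProbabilityTheory Filter Topology
open scoped NNReal ENNReal

namespace HadamardFBM

noncomputable section

/-- Lebesgue measure on the half line `ℝ⁺ = (0, ∞)`. -/
def volPos : Measure ℝ := (volume : Measure ℝ).restrict (Set.Ioi 0)

/-! ### Hadamard fractional operators -/

/-- Convergence of the integral that defines the Hadamard integral of order `β` at `x`. -/
def HadamardIntExists (β : ℝ) (f : ℝ → ℝ) (x : ℝ) : Prop :=
  IntegrableOn (fun z => Real.log (z / x) ^ (β - 1) * f z / z) (Set.Ioi x)

/-- The right-sided Hadamard integral of order `β > 0` at `x > 0`,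
`Γ(β)⁻¹ ∫_x^∞ (log (z / x)) ^ (β - 1) f(z) dz / z`. -/
def hadamardInt (β : ℝ) (f : ℝ → ℝ) (x : ℝ) : ℝ :=
  (Real.Gamma β)⁻¹ * ∫ z in Set.Ioi x, Real.log (z / x) ^ (β - 1) * f z / z

/-- The Hadamard derivative of order `β ∈ (0, 1)` exists at `x`: the Hadamard integral of order
`1 - β` converges near `x` and is differentiable at `x`. -/
def HadamardDerivExists (β : ℝ) (f : ℝ → ℝ) (x : ℝ) : Prop :=
  (∀ᶠ y in 𝓝 x, HadamardIntExists (1 - β) f y) ∧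
    DifferentiableAt ℝ (hadamardInt (1 - β) f) x

/-- The right-sided Hadamard derivative of order `β ∈ (0, 1)` (only such orders are used),
`- x d/dx` applied to the Hadamard integral of order `1 - β`. -/
def hadamardDeriv (β : ℝ) (f : ℝ → ℝ) (x : ℝ) : ℝ :=
  -x * deriv (hadamardInt (1 - β) f) x

/-- The constant `K_α = Γ((α + 1) / 2) / √Γ(α)`. -/
def constK (α : ℝ) : ℝ := Real.Gamma ((α + 1) / 2) / √(Real.Gamma α)

/-- The operator `M^α`: `K_α` times the Hadamard derivative of order `(1 - α) / 2` if `α < 1`, the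
identity if `α = 1`, and `K_α` times the Hadamard integral of order `(α - 1) / 2` if `α > 1`. -/
def opM (α : ℝ) (f : ℝ → ℝ) (x : ℝ) : ℝ :=
  if α < 1 then constK α * hadamardDeriv ((1 - α) / 2) f x
  else if α = 1 then f x
  else constK α * hadamardInt ((α - 1) / 2) f x

/-- `M^α f` is defined almost everywhere on the half line. -/
def OpMExists (α : ℝ) (f : ℝ → ℝ) : Prop :=
  ∀ᵐ x ∂volPos, (α < 1 → HadamardDerivExists ((1 - α) / 2) f x) ∧
    (1 < α → HadamardIntExists ((α - 1) / 2) f x)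

/-- The inverse operator: the Hadamard integral of order `(1 - α) / 2` if `α < 1`, the
identity if `α = 1`, and the Hadamard derivative of order `(α - 1) / 2` if `α > 1`. -/
def opMBar (α : ℝ) (f : ℝ → ℝ) (x : ℝ) : ℝ :=
  if α < 1 then hadamardInt ((1 - α) / 2) f x
  else if α = 1 then f x
  else hadamardDeriv ((α - 1) / 2) f x

/-- The inverse operator applied to `f` is defined almost everywhere on the half line. -/
def OpMBarExists (α : ℝ) (f : ℝ → ℝ) : Prop :=
  ∀ᵐ x ∂volPos, (α < 1 → HadamardIntExists ((1 - α) / 2) f x) ∧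
    (1 < α → HadamardDerivExists ((α - 1) / 2) f x)

/-- The indicator function of `[0, t)`. -/
def ind (t : ℝ≥0) : ℝ → ℝ := (Set.Ico (0 : ℝ) t).indicator (fun _ => 1)

/-! ### Step functions and Wiener integrals -/

/-- A step function on the half line, presented as a finite linear combination of indicators of
intervals `[left k, right k)`. (The intervals may overlap: this gives the same functions, and the
same integrals, as presentations with consecutive intervals.) -/
structure Step where
  n : ℕ
  coef : Fin n → ℝ
  left : Fin n → ℝ≥0
  right : Fin n → ℝ≥0
  le : ∀ k, left k ≤ right k

/-- The step function as a function. -/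
def Step.fn (φ : Step) (x : ℝ) : ℝ :=
  ∑ k, φ.coef k * (Set.Ico (φ.left k : ℝ) (φ.right k)).indicator (fun _ => (1 : ℝ)) x

variable {Ω : Type*}

/-- The integral of a step function with respect to a process `X`:
`∑ k, coef k * (X (right k) - X (left k))`. -/
def Step.integral (φ : Step) (X : ℝ≥0 → Ω → ℝ) (ω : Ω) : ℝ :=
  ∑ k, φ.coef k * (X (φ.right k) ω - X (φ.left k) ω)

variable [MeasurableSpace Ω]

/-- `Y` is (a version of) the Wiener integral `∫_0^∞ g(s) dB(s)` of `g ∈ L²(ℝ⁺)`: the limit in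
`L²(P)` of the integrals of step functions that converge to `g` in `L²(ℝ⁺)`. -/
structure IsWienerIntegral (P : Measure Ω) (B : ℝ≥0 → Ω → ℝ) (g : ℝ → ℝ) (Y : Ω → ℝ) :
    Prop where
  memLp_integrand : MemLp g 2 volPos
  memLp : MemLp Y 2 P
  limit : ∃ φ : ℕ → Step,
    Tendsto (fun m => eLpNorm (fun x => g x - (φ m).fn x) 2 volPos) atTop (𝓝 0) ∧
    Tendsto (fun m => eLpNorm (fun ω => Y ω - (φ m).integral B ω) 2 P) atTop (𝓝 0)

/-- `BH` is the Hadamard fractional Brownian motion with parameter `α` driven by `B`: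
for every `t`, `BH t` is the Wiener integral of `M^α 1_{[0, t)}` with respect to `B`. -/
def IsHadamardFBM (α : ℝ) (P : Measure Ω) (B BH : ℝ≥0 → Ω → ℝ) : Prop :=
  ∀ t : ℝ≥0, IsWienerIntegral P B (opM α (ind t)) (BH t)

/-! ### The integral with respect to the Hadamard fractional Brownian motion -/

/-- Membership in `L_{2,α} = {f : M^α f ∈ L²(ℝ⁺)}`. -/
def MemL2Alpha (α : ℝ) (f : ℝ → ℝ) : Prop :=
  OpMExists α f ∧ MemLp (opM α f) 2 volPos

/-- The step functions `φ m` converge to `f` in the norm `‖M^α ·‖_{L²(ℝ⁺)}` of `L_{2,α}`. -/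
def StepTendsto (α : ℝ) (φ : ℕ → Step) (f : ℝ → ℝ) : Prop :=
  Tendsto (fun m => eLpNorm (opM α (fun x => f x - (φ m).fn x)) 2 volPos) atTop (𝓝 0)

/-- `Y` is (a version of) the integral `∫_0^∞ f(s) dBH(s)` with respect to the Hadamard fractional
Brownian motion `BH` driven by `B`: `f` lies in `L_{2,α}`, `Y` is the Wiener integral of `M^α f`
with respect to `B`, and `Y` is also the limit in `L²(P)` of the integrals
`∑ k, coef k * (BH (right k) - BH (left k))` along any sequence of step functions that converges
to `f` in `L_{2,α}`, such sequences being available. -/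
structure IsHadamardIntegral (α : ℝ) (P : Measure Ω) (B BH : ℝ≥0 → Ω → ℝ) (f : ℝ → ℝ)
    (Y : Ω → ℝ) : Prop where
  mem : MemL2Alpha α f
  wiener : IsWienerIntegral P B (opM α f) Y
  exists_approx : ∃ φ : ℕ → Step, StepTendsto α φ f
  limit : ∀ φ : ℕ → Step, StepTendsto α φ f →
    Tendsto (fun m => eLpNorm (fun ω => Y ω - (φ m).integral BH ω) 2 P) atTop (𝓝 0)

end

end HadamardFBM

/-! Put μ = (α - 1)/2, so |μ| < 1/2. Up to `constK α`, M^α is the Hadamard operator of order μ, a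
negative order meaning a derivative, and the inverse operator has order -μ. By a Beta integral,
order ν sends log(t/·)^δ on (0, t) to Γ(δ+1)/Γ(δ+ν+1) times log(t/·)^(δ+ν) (`hasFrac_logPow`). Hence
both integrands are almost everywhere multiples of log(t/·)^(-μ), M^α returns a multiple of
1_{[0,t)}, and its Wiener integral is that multiple of B(t).

Two points remain. Along any admissible step sequence the integrals converge because the Wiener
integral is an isometry (`eLpNorm_sub_integral_eq`). Such sequences exist because M^α of a step
function is a combination of the functions log(v/·)^μ, and these approximate 1_{(0,t)} in L²
(`exists_seq_tendsto_logPow_zero`): anything orthogonal to all of them is, by Fubini, orthogonal to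
every log(t/·), and difference quotients of log(t/·) in log t tend to 1_{(0,t)}. -/

namespace HadamardFBM

noncomputable section

/-! ### Hadamard operators on powers of the logarithm -/

/-- The function `log (t / z) ^ δ` on `(0, t)`, extended by zero. -/
def logPow (δ t z : ℝ) : ℝ := (Set.Ioo 0 t).indicator (fun z => Real.log (t / z) ^ δ) z

lemma logPow_of_mem {δ t z : ℝ} (hz : 0 < z) (hzt : z < t) :
    logPow δ t z = Real.log (t / z) ^ δ := Set.indicator_of_mem (s := Set.Ioo 0 t) ⟨hz, hzt⟩ _

lemma logPow_of_le {δ t z : ℝ} (h : t ≤ z) : logPow δ t z = 0 :=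
  Set.indicator_of_notMem (fun h' => absurd h'.2 (not_lt.2 h)) _

lemma logPow_nonneg (δ t z : ℝ) : 0 ≤ logPow δ t z := by
  refine Set.indicator_nonneg (fun y hy => Real.rpow_nonneg (Real.log_nonneg ?_) _) z
  rw [one_le_div hy.1]
  exact hy.2.le

lemma ind_eq_logPow (t : ℝ≥0) {x : ℝ} (hx : 0 < x) : ind t x = logPow 0 t x := by
  by_cases h : x < t
  · rw [logPow_of_mem hx h, Real.rpow_zero]
    exact Set.indicator_of_mem (s := Set.Ico (0 : ℝ) t) ⟨hx.le, h⟩ _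
  · rw [logPow_of_le (not_lt.1 h)]
    exact Set.indicator_of_notMem (fun h' => h h'.2) _

lemma integral_rpow_mul_one_sub_rpow {γ η : ℝ} (hγ : 0 < γ) (hη : 0 < η) :
    IntegrableOn (fun s : ℝ => s ^ (γ - 1) * (1 - s) ^ (η - 1)) (Set.Ioo 0 1) ∧
      ∫ s in Set.Ioo (0 : ℝ) 1, s ^ (γ - 1) * (1 - s) ^ (η - 1) =
        Real.Gamma γ * Real.Gamma η / Real.Gamma (γ + η) := by
  have key : Set.EqOn (fun s : ℝ => (s : ℂ) ^ ((γ : ℂ) - 1) * (1 - (s : ℂ)) ^ ((η : ℂ) - 1))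
      (fun s : ℝ => ((s ^ (γ - 1) * (1 - s) ^ (η - 1) : ℝ) : ℂ)) (Set.Ioc 0 1) := by
    intro s hs
    have h1 : (0 : ℝ) ≤ 1 - s := by linarith [hs.2]
    simp only
    rw [Complex.ofReal_mul, Complex.ofReal_cpow hs.1.le, Complex.ofReal_cpow h1]
    push_cast
    rfl
  have hc := Complex.betaIntegral_convergent (u := γ) (v := η) (by simpa) (by simpa)
  rw [intervalIntegrable_iff_integrableOn_Ioc_of_le zero_le_one] at hc
  have hi := (hc.congr_fun key measurableSet_Ioc).re
  refine ⟨IntegrableOn.mono_set (by exact hi) Set.Ioo_subset_Ioc_self, ?_⟩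
  have hb := Complex.betaIntegral_eq_Gamma_mul_div (γ : ℂ) (η : ℂ) (by simpa) (by simpa)
  rw [Complex.betaIntegral, intervalIntegral.integral_of_le zero_le_one,
    setIntegral_congr_fun measurableSet_Ioc key, integral_complex_ofReal,
    ← Complex.ofReal_add, Complex.Gamma_ofReal, Complex.Gamma_ofReal, Complex.Gamma_ofReal] at hb
  rw [← integral_Ioc_eq_integral_Ioo]
  exact_mod_cast hb

lemma image_mul_exp_Ioo {x t : ℝ} (hx : 0 < x) (hxt : x < t) :
    (fun s => x * Real.exp (Real.log (t / x) * s)) '' Set.Ioo 0 1 = Set.Ioo x t := by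
  have ht : 0 < t := hx.trans hxt
  have hL : 0 < Real.log (t / x) := Real.log_pos ((one_lt_div hx).2 hxt)
  have hexp : x * Real.exp (Real.log (t / x)) = t := by
    rw [Real.exp_log (by positivity)]
    field_simp
  ext z
  constructor
  · rintro ⟨s, hs, rfl⟩
    constructor
    · have : 1 < Real.exp (Real.log (t / x) * s) := Real.one_lt_exp_iff.2 (mul_pos hL hs.1)
      simpa using mul_lt_mul_of_pos_left this hx
    · calc x * Real.exp (Real.log (t / x) * s) < x * Real.exp (Real.log (t / x)) := by
            gcongr
            nlinarith [hs.2]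
        _ = t := hexp
  · intro hz
    have hz0 : 0 < z := hx.trans hz.1
    refine ⟨Real.log (z / x) / Real.log (t / x), ⟨?_, ?_⟩, ?_⟩
    · exact div_pos (Real.log_pos ((one_lt_div hx).2 hz.1)) hL
    · rw [div_lt_one hL]
      apply Real.log_lt_log (by positivity)
      gcongr
      exact hz.2
    · simp only
      rw [mul_div_cancel₀ _ hL.ne', Real.exp_log (by positivity)]
      field_simp

/-- Substitute z = x exp(L s) with L = log(t/x): then log(z/x) = L s, log(t/z) = L(1 - s) and dz/z =
L ds, which leaves a Beta integral times L^(γ+δ). -/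
lemma integral_log_rpow_mul_log_rpow {γ δ x t : ℝ} (hγ : 0 < γ) (hδ : -1 < δ) (hx : 0 < x)
    (hxt : x < t) :
    IntegrableOn (fun z => Real.log (z / x) ^ (γ - 1) * Real.log (t / z) ^ δ / z) (Set.Ioo x t) ∧
      ∫ z in Set.Ioo x t, Real.log (z / x) ^ (γ - 1) * Real.log (t / z) ^ δ / z =
        Real.Gamma γ * Real.Gamma (δ + 1) / Real.Gamma (γ + δ + 1) *
          Real.log (t / x) ^ (γ + δ) := by
  have ht : 0 < t := hx.trans hxt
  have hL : 0 < Real.log (t / x) := Real.log_pos ((one_lt_div hx).2 hxt)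
  set L := Real.log (t / x) with hLdef
  have hder : ∀ s ∈ Set.Ioo (0 : ℝ) 1, HasDerivWithinAt (fun s => x * Real.exp (L * s))
      (x * (Real.exp (L * s) * L)) (Set.Ioo 0 1) s := by
    intro s _
    have h1 : HasDerivAt (fun s => L * s) L s := by simpa using (hasDerivAt_id s).const_mul L
    exact (h1.exp.const_mul x).hasDerivWithinAt
  have hinj : Set.InjOn (fun s => x * Real.exp (L * s)) (Set.Ioo 0 1) := by
    intro a _ b _ hab
    have h2 := Real.exp_injective (mul_left_cancel₀ hx.ne' hab)
    exact mul_left_cancel₀ hL.ne' h2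
  have himg := image_mul_exp_Ioo hx hxt
  rw [← hLdef] at himg
  have hpt : Set.EqOn (fun s => |x * (Real.exp (L * s) * L)| •
      (fun z => Real.log (z / x) ^ (γ - 1) * Real.log (t / z) ^ δ / z) (x * Real.exp (L * s)))
      (fun s => L ^ (γ + δ) * (s ^ (γ - 1) * (1 - s) ^ (δ + 1 - 1))) (Set.Ioo 0 1) := by
    intro s hs
    have e1 : Real.log (x * Real.exp (L * s) / x) = L * s := by
      rw [mul_div_cancel_left₀ _ hx.ne', Real.log_exp]
    have e2 : Real.log (t / (x * Real.exp (L * s))) = L * (1 - s) := by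
      rw [← div_div, Real.log_div (by positivity) (Real.exp_ne_zero _), Real.log_exp, ← hLdef]
      ring
    have h1s : 0 ≤ 1 - s := by linarith [hs.2]
    simp only [smul_eq_mul]
    rw [e1, e2, abs_of_pos (by positivity), Real.mul_rpow hL.le hs.1.le, Real.mul_rpow hL.le h1s,
      add_sub_cancel_right]
    have e3 : L ^ (γ + δ) = L ^ (γ - 1) * L ^ δ * L := by
      rw [← Real.rpow_add hL, ← Real.rpow_add_one hL.ne']
      congr 1
      ring
    rw [e3]
    have := Real.exp_ne_zero (L * s)
    field_simp
  obtain ⟨hb1, hb2⟩ := integral_rpow_mul_one_sub_rpow hγ (show 0 < δ + 1 by linarith)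
  rw [← himg, integrableOn_image_iff_integrableOn_abs_deriv_smul measurableSet_Ioo hder hinj,
    integral_image_eq_integral_abs_deriv_smul measurableSet_Ioo hder hinj]
  refine ⟨IntegrableOn.congr_fun (hb1.const_mul _) hpt.symm measurableSet_Ioo, ?_⟩
  rw [setIntegral_congr_fun measurableSet_Ioo hpt, integral_const_mul, hb2, ← add_assoc]
  ring

lemma integral_hadamard_logPow {γ δ x : ℝ} (t : ℝ) (hγ : 0 < γ) (hδ : -1 < δ) (hx : 0 < x) :
    HadamardIntExists γ (logPow δ t) x ∧
      ∫ z in Set.Ioi x, Real.log (z / x) ^ (γ - 1) * logPow δ t z / z =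
        Real.Gamma γ * Real.Gamma (δ + 1) / Real.Gamma (γ + δ + 1) * logPow (γ + δ) t x := by
  have hEq : Set.EqOn (fun z => Real.log (z / x) ^ (γ - 1) * logPow δ t z / z)
      ((Set.Ioo x t).indicator
        (fun z => Real.log (z / x) ^ (γ - 1) * Real.log (t / z) ^ δ / z)) (Set.Ioi x) := by
    intro z hz
    have hz' : x < z := hz
    by_cases h : z < t
    · rw [Set.indicator_of_mem (show z ∈ Set.Ioo x t from ⟨hz, h⟩)]
      simp only
      rw [logPow_of_mem (hx.trans hz') h]
    · rw [Set.indicator_of_notMem (fun h' => h h'.2)]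
      simp only
      rw [logPow_of_le (not_lt.1 h), mul_zero, zero_div]
  unfold HadamardIntExists
  rw [integrableOn_congr_fun hEq measurableSet_Ioi, setIntegral_congr_fun measurableSet_Ioi hEq]
  by_cases hxt : x < t
  · obtain ⟨h1, h2⟩ := integral_log_rpow_mul_log_rpow hγ hδ hx hxt
    constructor
    · exact ((integrable_indicator_iff measurableSet_Ioo).2 h1).integrableOn
    · rw [setIntegral_indicator measurableSet_Ioo,
        Set.inter_eq_right.2 Set.Ioo_subset_Ioi_self, h2, logPow_of_mem hx hxt]
  · rw [Set.Ioo_eq_empty hxt, logPow_of_le (not_lt.1 hxt)]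
    simp

lemma hadamardInt_logPow {γ δ x : ℝ} (t : ℝ) (hγ : 0 < γ) (hδ : -1 < δ) (hx : 0 < x) :
    hadamardInt γ (logPow δ t) x =
      Real.Gamma (δ + 1) / Real.Gamma (γ + δ + 1) * logPow (γ + δ) t x := by
  rw [hadamardInt, (integral_hadamard_logPow t hγ hδ hx).2]
  have := (Real.Gamma_pos_of_pos hγ).ne'
  field_simp

lemma hasDerivAt_logPow {ρ t x : ℝ} (hx : 0 < x) (hxt : x ≠ t) :
    HasDerivAt (logPow ρ t) (-(ρ * logPow (ρ - 1) t x) / x) x := by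
  rcases lt_or_gt_of_ne hxt with h | h
  · have ht : 0 < t := hx.trans h
    have hL : 0 < Real.log (t / x) := Real.log_pos ((one_lt_div hx).2 h)
    have h0 : HasDerivAt (fun z => t / z) (-t / x ^ 2) x := by
      simpa [div_eq_mul_inv, neg_mul, mul_neg] using (hasDerivAt_inv hx.ne').const_mul t
    have h1 : HasDerivAt (fun z => Real.log (t / z) ^ ρ) _ x :=
      (h0.log (by positivity)).rpow_const (p := ρ) (Or.inl hL.ne')
    have h2 : logPow ρ t =ᶠ[𝓝 x] fun z => Real.log (t / z) ^ ρ := by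
      filter_upwards [Ioo_mem_nhds hx h] with z hz using logPow_of_mem hz.1 hz.2
    refine (h1.congr_of_eventuallyEq h2).congr_deriv ?_
    rw [logPow_of_mem hx h]
    field_simp
  · have h2 : logPow ρ t =ᶠ[𝓝 x] fun _ => 0 := by
      filter_upwards [Ioi_mem_nhds h] with z hz using logPow_of_le (le_of_lt hz)
    refine ((hasDerivAt_const x (0 : ℝ)).congr_of_eventuallyEq h2).congr_deriv ?_
    rw [logPow_of_le h.le]
    simp

/-- The Hadamard operator of order `ν` (the derivative of order `-ν` if `ν < 0`, the integral of
order `ν` if `ν > 0`) applied to `f` exists at `x` and has the value `y`. -/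
structure HasFrac (ν : ℝ) (f : ℝ → ℝ) (x y : ℝ) : Prop where
  deriv : ν < 0 → (∀ᶠ y in 𝓝 x, HadamardIntExists (1 + ν) f y) ∧
    ∃ d, HasDerivAt (hadamardInt (1 + ν) f) d x ∧ y = -x * d
  int : 0 < ν → HadamardIntExists ν f x ∧ hadamardInt ν f x = y

/-- For ν < 0, integration of order 1 + ν gives the exponent δ + ν + 1; differentiating lowers it by
one and produces the factor δ + ν + 1, absorbed by Γ(s + 1) = s Γ(s). The point x = t is excluded
because the power may be singular there. -/
lemma hasFrac_logPow {ν δ x : ℝ} (t : ℝ) (hν : -1 < ν) (hδ : -1 < δ)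
    (hδν : -1 < δ + ν) (hx : 0 < x) (hxt : x ≠ t) :
    HasFrac ν (logPow δ t) x
      (Real.Gamma (δ + 1) / Real.Gamma (δ + ν + 1) * logPow (δ + ν) t x) := by
  constructor
  · intro _
    have hev : ∀ᶠ y in 𝓝 x, 0 < y := Ioi_mem_nhds hx
    have h1 : 0 < 1 + ν := by linarith
    refine ⟨hev.mono fun y hy => (integral_hadamard_logPow t h1 hδ hy).1, _,
      ((hasDerivAt_logPow hx hxt).const_mul _).congr_of_eventuallyEq
        (hev.mono fun y hy => hadamardInt_logPow t h1 hδ hy), ?_⟩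
    have h2 : 0 < δ + ν + 1 := by linarith
    rw [show 1 + ν + δ + 1 = (δ + ν + 1) + 1 by ring, Real.Gamma_add_one h2.ne',
      show 1 + ν + δ - 1 = δ + ν by ring]
    have := (Real.Gamma_pos_of_pos h2).ne'
    field_simp
    ring
  · intro h
    refine ⟨(integral_hadamard_logPow t h hδ hx).1, ?_⟩
    rw [hadamardInt_logPow t h hδ hx, add_comm ν δ]

/-! ### Linearity and almost-everywhere invariance of the Hadamard operators -/

lemma hadamardInt_add {γ : ℝ} {f g : ℝ → ℝ} {x : ℝ} (hf : HadamardIntExists γ f x)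
    (hg : HadamardIntExists γ g x) :
    HadamardIntExists γ (fun z => f z + g z) x ∧
      hadamardInt γ (fun z => f z + g z) x = hadamardInt γ f x + hadamardInt γ g x := by
  have e : (fun z => Real.log (z / x) ^ (γ - 1) * (f z + g z) / z) =
      fun z => Real.log (z / x) ^ (γ - 1) * f z / z + Real.log (z / x) ^ (γ - 1) * g z / z := by
    ext z; ring
  unfold HadamardIntExists hadamardInt
  rw [e, integral_add hf hg]
  exact ⟨Integrable.add hf hg, by ring⟩

lemma hadamardInt_const_mul {γ : ℝ} {f : ℝ → ℝ} {x : ℝ} (c : ℝ) (hf : HadamardIntExists γ f x) :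
    HadamardIntExists γ (fun z => c * f z) x ∧
      hadamardInt γ (fun z => c * f z) x = c * hadamardInt γ f x := by
  have e : (fun z => Real.log (z / x) ^ (γ - 1) * (c * f z) / z) =
      fun z => c * (Real.log (z / x) ^ (γ - 1) * f z / z) := by
    ext z; ring
  unfold HadamardIntExists hadamardInt
  rw [e, integral_const_mul]
  exact ⟨Integrable.const_mul hf c, by ring⟩

lemma hadamardInt_congr_ae {γ : ℝ} {f g : ℝ → ℝ} {x : ℝ} (hx : 0 < x) (h : f =ᵐ[volPos] g) :
    (HadamardIntExists γ f x ↔ HadamardIntExists γ g x) ∧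
      hadamardInt γ f x = hadamardInt γ g x := by
  have h' : f =ᵐ[volume.restrict (Set.Ioi x)] g :=
    ae_restrict_of_ae_restrict_of_subset (Set.Ioi_subset_Ioi hx.le) h
  have e : (fun z => Real.log (z / x) ^ (γ - 1) * f z / z) =ᵐ[volume.restrict (Set.Ioi x)]
      fun z => Real.log (z / x) ^ (γ - 1) * g z / z := by
    filter_upwards [h'] with z hz
    rw [hz]
  unfold HadamardIntExists hadamardInt
  rw [integral_congr_ae e]
  exact ⟨integrable_congr e, rfl⟩

namespace HasFrac

variable {ν : ℝ} {f g : ℝ → ℝ} {x y y' : ℝ}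

lemma add (hf : HasFrac ν f x y) (hg : HasFrac ν g x y') :
    HasFrac ν (fun z => f z + g z) x (y + y') := by
  constructor
  · intro h
    obtain ⟨hf1, d, hf2, rfl⟩ := hf.deriv h
    obtain ⟨hg1, d', hg2, rfl⟩ := hg.deriv h
    refine ⟨(hf1.and hg1).mono fun z hz => (hadamardInt_add hz.1 hz.2).1, d + d',
      (hf2.add hg2).congr_of_eventuallyEq
        ((hf1.and hg1).mono fun z hz => (hadamardInt_add hz.1 hz.2).2), by ring⟩
  · intro h
    obtain ⟨hf1, rfl⟩ := hf.int h
    obtain ⟨hg1, rfl⟩ := hg.int h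
    exact hadamardInt_add hf1 hg1

lemma const_mul (c : ℝ) (hf : HasFrac ν f x y) : HasFrac ν (fun z => c * f z) x (c * y) := by
  constructor
  · intro h
    obtain ⟨hf1, d, hf2, rfl⟩ := hf.deriv h
    refine ⟨hf1.mono fun z hz => (hadamardInt_const_mul c hz).1, c * d,
      (hf2.const_mul c).congr_of_eventuallyEq
        (hf1.mono fun z hz => (hadamardInt_const_mul c hz).2), by ring⟩
  · intro h
    obtain ⟨hf1, rfl⟩ := hf.int h
    exact hadamardInt_const_mul c hf1

lemma congr_ae (hx : 0 < x) (h : f =ᵐ[volPos] g) (hf : HasFrac ν f x y) : HasFrac ν g x y := by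
  have hev : ∀ᶠ y in 𝓝 x, 0 < y := Ioi_mem_nhds hx
  constructor
  · intro hν
    obtain ⟨hf1, d, hf2, rfl⟩ := hf.deriv hν
    exact ⟨(hev.and hf1).mono fun z hz => (hadamardInt_congr_ae hz.1 h).1.1 hz.2, d,
      hf2.congr_of_eventuallyEq (hev.mono fun z hz => (hadamardInt_congr_ae hz h).2.symm), rfl⟩
  · intro hν
    obtain ⟨hf1, rfl⟩ := hf.int hν
    exact ⟨(hadamardInt_congr_ae hx h).1.1 hf1, (hadamardInt_congr_ae hx h).2.symm⟩

lemma sub (hf : HasFrac ν f x y) (hg : HasFrac ν g x y') :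
    HasFrac ν (fun z => f z - g z) x (y - y') := by
  simpa [sub_eq_add_neg] using hf.add (hg.const_mul (-1))

lemma zero : HasFrac ν (fun _ => 0) x 0 := by
  have h0 : ∀ γ y, HadamardIntExists γ (fun _ => 0) y := fun γ y => by simp [HadamardIntExists]
  have h1 : ∀ γ, hadamardInt γ (fun _ => 0) = fun _ => 0 := fun γ => by
    ext y; simp [hadamardInt]
  refine ⟨fun _ => ⟨.of_forall fun _ => h0 _ _, 0, ?_, by simp⟩, fun _ => ⟨h0 _ _, by rw [h1]⟩⟩
  rw [h1]
  exact hasDerivAt_const x 0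

lemma sum {ι : Type*} (s : Finset ι) {F : ι → ℝ → ℝ} {Y : ι → ℝ}
    (h : ∀ i, HasFrac ν (F i) x (Y i)) :
    HasFrac ν (fun z => ∑ i ∈ s, F i z) x (∑ i ∈ s, Y i) := by
  classical
  induction s using Finset.induction_on with
  | empty => simpa using HasFrac.zero
  | insert i s hi ih =>
    simp only [Finset.sum_insert hi]
    exact (h i).add ih

lemma hadamardDeriv (h : HasFrac ν f x y) (hν : ν < 0) :
    HadamardDerivExists (-ν) f x ∧ hadamardDeriv (-ν) f x = y := by
  obtain ⟨h1, d, h2, rfl⟩ := h.deriv hν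
  rw [HadamardDerivExists, HadamardFBM.hadamardDeriv, sub_neg_eq_add]
  exact ⟨⟨h1, h2.differentiableAt⟩, by rw [h2.deriv]⟩

end HasFrac

/-! ### The operators M^α and their inverses as operators of signed order -/

variable {α : ℝ} {f : ℝ → ℝ}

lemma hasFrac_opM {x y : ℝ} (h : HasFrac ((α - 1) / 2) f x y) (hα : α ≠ 1) :
    ((α < 1 → HadamardDerivExists ((1 - α) / 2) f x) ∧
      (1 < α → HadamardIntExists ((α - 1) / 2) f x)) ∧ opM α f x = constK α * y := by
  have e : -((α - 1) / 2) = (1 - α) / 2 := by ring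
  rcases lt_or_gt_of_ne hα with h1 | h1
  · have := h.hadamardDeriv (by linarith)
    rw [e] at this
    refine ⟨⟨fun _ => this.1, fun h2 => absurd h1 h2.not_gt⟩, ?_⟩
    rw [opM, if_pos h1, this.2]
  · have := h.int (by linarith)
    refine ⟨⟨fun h2 => absurd h1 h2.not_gt, fun _ => this.1⟩, ?_⟩
    rw [opM, if_neg h1.not_gt, if_neg hα, this.2]

lemma hasFrac_opMBar {x y : ℝ} (h : HasFrac ((1 - α) / 2) f x y) (hα : α ≠ 1) :
    ((α < 1 → HadamardIntExists ((1 - α) / 2) f x) ∧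
      (1 < α → HadamardDerivExists ((α - 1) / 2) f x)) ∧ opMBar α f x = y := by
  have e : -((1 - α) / 2) = (α - 1) / 2 := by ring
  rcases lt_or_gt_of_ne hα with h1 | h1
  · have := h.int (by linarith)
    refine ⟨⟨fun _ => this.1, fun h2 => absurd h1 h2.not_gt⟩, ?_⟩
    rw [opMBar, if_pos h1, this.2]
  · have := h.hadamardDeriv (by linarith)
    rw [e] at this
    refine ⟨⟨fun h2 => absurd h1 h2.not_gt, fun _ => this.1⟩, ?_⟩
    rw [opMBar, if_neg h1.not_gt, if_neg hα, this.2]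

/-! ### Density of powers of the logarithm in `L²(ℝ⁺)` -/

instance sFinite_volPos : SFinite volPos := by
  unfold volPos
  infer_instance

lemma ae_volPos_pos : ∀ᵐ x ∂volPos, 0 < x := ae_restrict_mem measurableSet_Ioi

lemma ae_volPos_ne (t : ℝ) : ∀ᵐ x ∂volPos, x ≠ t :=
  ae_restrict_of_ae (Measure.ae_ne volume t)

/-- Passes from functions to elements of L², where Hilbert space arguments apply; used over the half
line and over Ω. -/
lemma eLpNorm_sub_sum {X ι : Type*} [MeasurableSpace X] {μ : Measure X} (s : Finset ι) (c : ι → ℝ)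
    {F : ι → X → ℝ} (hF : ∀ i, MemLp (F i) 2 μ) {g : X → ℝ} (hg : MemLp g 2 μ) :
    eLpNorm (fun x => g x - ∑ i ∈ s, c i * F i x) 2 μ =
      ‖hg.toLp g - ∑ i ∈ s, c i • (hF i).toLp (F i)‖ₑ := by
  have hS : MemLp (fun x => ∑ i ∈ s, c i * F i x) 2 μ :=
    memLp_finsetSum s fun i _ => (hF i).const_mul (c i)
  have h1 : ∑ i ∈ s, c i • (hF i).toLp (F i) = hS.toLp _ := by
    apply Lp.ext
    have h2 : ∀ i ∈ s, (c i • (hF i).toLp (F i) : Lp ℝ 2 μ) =ᵐ[μ] fun x => c i * F i x := by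
      intro i _
      filter_upwards [Lp.coeFn_smul (c i) ((hF i).toLp (F i)), (hF i).coeFn_toLp] with x h3 h4
      rw [h3, Pi.smul_apply, h4, smul_eq_mul]
    have h5 := (ae_ball_iff s.countable_toSet).2 h2
    filter_upwards [Lp.coeFn_finsetSum s (fun i => c i • (hF i).toLp (F i)), hS.coeFn_toLp, h5]
      with x h3 h4 h6
    rw [h3, h4, Finset.sum_apply]
    exact Finset.sum_congr rfl h6
  rw [h1, ← MemLp.toLp_sub, Lp.enorm_toLp]
  rfl

lemma measurable_logPow (δ t : ℝ) : Measurable (logPow δ t) :=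
  Measurable.indicator (by fun_prop) measurableSet_Ioo

lemma measurable_logPow_uncurry (δ : ℝ) : Measurable fun p : ℝ × ℝ => logPow δ p.2 p.1 := by
  have hs : MeasurableSet {p : ℝ × ℝ | 0 < p.1 ∧ p.1 < p.2} :=
    (measurableSet_lt measurable_const measurable_fst).inter
      (measurableSet_lt measurable_fst measurable_snd)
  exact Measurable.indicator
    (show Measurable fun p : ℝ × ℝ => Real.log (p.2 / p.1) ^ δ by fun_prop) hs

lemma image_mul_exp_neg_Ioi {t : ℝ} (ht : 0 < t) :
    (fun u => t * Real.exp (-u)) '' Set.Ioi 0 = Set.Ioo 0 t := by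
  ext z
  constructor
  · rintro ⟨u, hu, rfl⟩
    have : Real.exp (-u) < 1 := Real.exp_lt_one_iff.2 (neg_lt_zero.2 hu)
    exact ⟨by positivity, by simpa using mul_lt_mul_of_pos_left this ht⟩
  · intro hz
    have hz0 : 0 < z := hz.1
    refine ⟨Real.log (t / z), Real.log_pos ((one_lt_div hz.1).2 hz.2), ?_⟩
    simp only
    rw [Real.exp_neg, Real.exp_log (by positivity)]
    field_simp

/-- The substitution z = t exp(-u) turns this into the Gamma integral of order a + 1. -/
lemma integrableOn_log_rpow {a t : ℝ} (ha : -1 < a) (ht : 0 < t) :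
    IntegrableOn (fun z => Real.log (t / z) ^ a) (Set.Ioo 0 t) := by
  have hder : ∀ u ∈ Set.Ioi (0 : ℝ), HasDerivWithinAt (fun u => t * Real.exp (-u))
      (t * (Real.exp (-u) * -1)) (Set.Ioi 0) u := fun u _ =>
    ((hasDerivAt_neg u).exp.const_mul t).hasDerivWithinAt
  have hinj : Set.InjOn (fun u => t * Real.exp (-u)) (Set.Ioi 0) := by
    intro u _ v _ h
    exact neg_injective (Real.exp_injective (mul_left_cancel₀ ht.ne' h))
  rw [← image_mul_exp_neg_Ioi ht,
    integrableOn_image_iff_integrableOn_abs_deriv_smul measurableSet_Ioi hder hinj]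
  have h := (Real.GammaIntegral_convergent (s := a + 1) (by linarith)).const_mul t
  refine IntegrableOn.congr_fun h (fun u _ => ?_) measurableSet_Ioi
  have e2 : Real.log (t / (t * Real.exp (-u))) = u := by
    rw [← div_div, div_self ht.ne', one_div, ← Real.exp_neg, neg_neg, Real.log_exp]
  simp only [smul_eq_mul]
  rw [e2, mul_neg_one, mul_neg, abs_neg, abs_of_pos (by positivity), add_sub_cancel_right]
  ring

lemma memLp_logPow {δ : ℝ} (hδ : -(1 / 2) < δ) (t : ℝ) : MemLp (logPow δ t) 2 volPos := by
  rw [memLp_two_iff_integrable_sq (measurable_logPow δ t).aestronglyMeasurable]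
  rcases le_or_gt t 0 with ht | ht
  · refine (integrable_zero ℝ ℝ volPos).congr ?_
    filter_upwards [ae_volPos_pos] with x hx
    simp [logPow_of_le (ht.trans hx.le)]
  · have e : (fun x => logPow δ t x ^ 2) =
        (Set.Ioo 0 t).indicator (fun z => Real.log (t / z) ^ (2 * δ)) := by
      ext z
      by_cases hz : z ∈ Set.Ioo 0 t
      · have hl : 0 ≤ Real.log (t / z) :=
          Real.log_nonneg ((one_le_div hz.1).2 hz.2.le)
        rw [Set.indicator_of_mem hz, logPow_of_mem hz.1 hz.2, mul_comm 2 δ, Real.rpow_mul hl,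
          Real.rpow_two]
      · rw [Set.indicator_of_notMem hz, logPow, Set.indicator_of_notMem hz, sq, zero_mul]
    rw [e]
    exact ((integrable_indicator_iff measurableSet_Ioo).2
      (integrableOn_log_rpow (by linarith) ht)).integrableOn

/-- The function `logPow δ t` as an element of `L²(ℝ⁺)`. -/
def logPowLp {δ : ℝ} (hδ : -(1 / 2) < δ) (t : ℝ) : Lp ℝ 2 volPos :=
  (memLp_logPow hδ t).toLp (logPow δ t)

lemma inner_logPowLp {δ : ℝ} (hδ : -(1 / 2) < δ) (t : ℝ) (g : Lp ℝ 2 volPos) :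
    inner ℝ (logPowLp hδ t) g = ∫ x, g x * logPow δ t x ∂volPos := by
  rw [L2.inner_def]
  refine integral_congr_ae ?_
  filter_upwards [(memLp_logPow hδ t).coeFn_toLp] with x hx
  change g x * logPowLp hδ t x = _
  rw [logPowLp, hx]

/-- As a function of v, log(v/x)^μ is the kernel of the Hadamard integral of order μ + 1, and that
integral raises the exponent -μ to 1. -/
lemma integral_logPow_mul_logPow {μ x : ℝ} (hμ : -1 < μ) (hμ' : μ < 1) (t : ℝ) (hx : 0 < x) :
    Integrable (fun v => logPow μ v x * logPow (-μ) t v / v) volPos ∧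
      ∫ v, logPow μ v x * logPow (-μ) t v / v ∂volPos =
        Real.Gamma (μ + 1) * Real.Gamma (1 - μ) * logPow 1 t x := by
  have h := integral_hadamard_logPow (γ := μ + 1) (δ := -μ) t (by linarith) (by linarith) hx
  have e : Set.EqOn (fun v => logPow μ v x * logPow (-μ) t v / v)
      ((Set.Ioi x).indicator fun z => Real.log (z / x) ^ (μ + 1 - 1) * logPow (-μ) t z / z)
      (Set.Ioi 0) := by
    intro v _
    by_cases hv : x < v
    · rw [Set.indicator_of_mem (show v ∈ Set.Ioi x from hv), add_sub_cancel_right]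
      simp only
      rw [logPow_of_mem hx hv]
    · rw [Set.indicator_of_notMem (show v ∉ Set.Ioi x from hv)]
      simp only
      rw [logPow_of_le (not_lt.1 hv), zero_mul, zero_div]
  constructor
  · refine IntegrableOn.congr_fun ?_ e.symm measurableSet_Ioi
    exact ((integrable_indicator_iff measurableSet_Ioi).2 h.1).integrableOn
  · rw [volPos, setIntegral_congr_fun measurableSet_Ioi e, setIntegral_indicator measurableSet_Ioi,
      Set.inter_eq_right.2 (Set.Ioi_subset_Ioi hx.le), h.2, show μ + 1 + -μ + 1 = 2 by ring,
      show μ + 1 + -μ = 1 by ring, Real.Gamma_two, div_one, neg_add_eq_sub]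

/-- Integrate the orthogonality relations in v against `logPow (-μ) t v / v` and exchange the
integrals: the inner integral becomes a nonzero multiple of `logPow 1 t`. -/
lemma inner_logPowLp_one_eq_zero {μ : ℝ} (hμ : -(1 / 2) < μ) (hμ' : μ < 1) (g : Lp ℝ 2 volPos)
    (hg : ∀ v : ℝ, 0 < v → inner ℝ (logPowLp hμ v) g = 0) (t : ℝ) (h1 : -(1 / 2) < (1 : ℝ)) :
    inner ℝ (logPowLp h1 t) g = 0 := by
  set C := Real.Gamma (μ + 1) * Real.Gamma (1 - μ) with hC
  have hC0 : C ≠ 0 := (mul_pos (Real.Gamma_pos_of_pos (by linarith))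
    (Real.Gamma_pos_of_pos (by linarith))).ne'
  let F : ℝ → ℝ → ℝ := fun x v => g x * (logPow μ v x * logPow (-μ) t v / v)
  have hgm : AEStronglyMeasurable g volPos := Lp.aestronglyMeasurable g
  have hFm : AEStronglyMeasurable (Function.uncurry F) (volPos.prod volPos) := by
    refine hgm.comp_fst.mul (Measurable.aestronglyMeasurable ?_)
    exact ((measurable_logPow_uncurry μ).mul ((measurable_logPow (-μ) t).comp measurable_snd)).div
      measurable_snd
  have hint : Integrable (fun x => g x * logPow 1 t x) volPos :=
    (Lp.memLp g).integrable_mul (memLp_logPow h1 t)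
  have hF : Integrable (Function.uncurry F) (volPos.prod volPos) := by
    rw [integrable_prod_iff hFm]
    constructor
    · filter_upwards [ae_volPos_pos] with x hx
      exact (integral_logPow_mul_logPow (by linarith) hμ' t hx).1.const_mul (g x)
    -- The kernel is nonnegative, so the integral of the norm has the same closed form, and g times
    -- `logPow 1 t` is integrable as a product of L² functions.
    · refine (hint.norm.const_mul C).congr ?_
      filter_upwards [ae_volPos_pos] with x hx
      have e : ∀ᵐ v ∂volPos, ‖Function.uncurry F (x, v)‖ =
          |g x| * (logPow μ v x * logPow (-μ) t v / v) := by
        filter_upwards [ae_volPos_pos] with v hv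
        simp only [Function.uncurry_apply_pair, F, Real.norm_eq_abs]
        rw [abs_mul, abs_of_nonneg (div_nonneg
          (mul_nonneg (logPow_nonneg _ _ _) (logPow_nonneg _ _ _)) hv.le)]
      rw [integral_congr_ae e, integral_const_mul,
        (integral_logPow_mul_logPow (by linarith) hμ' t hx).2, Real.norm_eq_abs, abs_mul,
        abs_of_nonneg (logPow_nonneg _ _ _)]
      ring
  have hswap := integral_integral_swap hF
  have hl : ∫ x, ∫ v, F x v ∂volPos ∂volPos = C * ∫ x, g x * logPow 1 t x ∂volPos := by
    rw [← integral_const_mul]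
    refine integral_congr_ae ?_
    filter_upwards [ae_volPos_pos] with x hx
    simp only [F]
    rw [integral_const_mul, (integral_logPow_mul_logPow (by linarith) hμ' t hx).2]
    ring
  have hr : ∫ v, ∫ x, F x v ∂volPos ∂volPos = 0 := by
    rw [← integral_zero ℝ ℝ (μ := volPos)]
    refine integral_congr_ae ?_
    filter_upwards [ae_volPos_pos] with v hv
    have e : ∀ x, F x v = (g x * logPow μ v x) * (logPow (-μ) t v / v) := by
      intro x
      simp only [F]
      ring
    simp only [e]
    rw [integral_mul_const, ← inner_logPowLp hμ, hg v hv, zero_mul]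
  rw [hl, hr] at hswap
  rw [inner_logPowLp]
  exact (mul_eq_zero.1 hswap).resolve_left hC0

lemma logPow_one_mem_closure {μ : ℝ} (hμ : -(1 / 2) < μ) (hμ' : μ < 1) (t : ℝ)
    (h1 : -(1 / 2) < (1 : ℝ)) :
    logPowLp h1 t ∈
      (Submodule.span ℝ (Set.range fun v : ℝ≥0 => logPowLp hμ v)).topologicalClosure := by
  rw [← Submodule.orthogonal_orthogonal_eq_closure, Submodule.mem_orthogonal']
  intro g hg
  refine inner_logPowLp_one_eq_zero hμ hμ' g (fun v hv => ?_) t h1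
  exact (Submodule.mem_orthogonal _ _).1 hg _ (Submodule.subset_span ⟨⟨v, hv.le⟩, rfl⟩)

/-- Since log(t e^ε/x) = log(t/x) + ε, the quotient is exactly 1 on (0, t); it lies in [0, 1] on [t,
t e^ε) and vanishes beyond. -/
lemma abs_difference_quotient_sub_logPow_zero_le {ε t x : ℝ} (hε : 0 < ε) (hx : 0 < x) :
    ‖ε⁻¹ * (logPow 1 (t * Real.exp ε) x - logPow 1 t x) - logPow 0 t x‖ ≤
      ‖(Set.Ico t (t * Real.exp ε)).indicator (fun _ => (1 : ℝ)) x‖ := by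
  by_cases h1 : x < t
  · have ht : 0 < t := hx.trans h1
    have h2 : x < t * Real.exp ε := by
      have := mul_lt_mul_of_pos_left (Real.one_lt_exp_iff.2 hε) ht
      linarith
    rw [logPow_of_mem hx h1, logPow_of_mem hx h1, logPow_of_mem hx h2, Real.rpow_one, Real.rpow_one,
      Real.rpow_zero, Real.log_div (by positivity) hx.ne', Real.log_div ht.ne' hx.ne',
      Real.log_mul ht.ne' (Real.exp_ne_zero _), Real.log_exp,
      show Real.log t + ε - Real.log x - (Real.log t - Real.log x) = ε by ring,
      inv_mul_cancel₀ hε.ne', sub_self, norm_zero]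
    exact norm_nonneg _
  · rw [not_lt] at h1
    rw [logPow_of_le h1, logPow_of_le h1, sub_zero, sub_zero]
    by_cases h2 : x < t * Real.exp ε
    · have ht : 0 < t := by
        by_contra h
        have := mul_nonpos_of_nonpos_of_nonneg (not_lt.1 h) (Real.exp_pos ε).le
        linarith
      rw [Set.indicator_of_mem (show x ∈ Set.Ico _ _ from ⟨h1, h2⟩), logPow_of_mem hx h2,
        Real.rpow_one, norm_one]
      have h3 : 0 ≤ Real.log (t * Real.exp ε / x) :=
        Real.log_nonneg ((one_le_div hx).2 h2.le)
      have h4 : Real.log (t * Real.exp ε / x) ≤ ε := by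
        rw [Real.log_le_iff_le_exp (by positivity), div_le_iff₀ hx, mul_comm]
        gcongr
      rw [Real.norm_of_nonneg (by positivity), inv_mul_le_iff₀ hε, mul_one]
      exact h4
    · rw [logPow_of_le (not_lt.1 h2), mul_zero, norm_zero]
      exact norm_nonneg _

/-- The difference quotients of `logPow 1` in log t lie in the closed span, and their L² error is at
most the square root of the length of [t, t e^ε). -/
lemma logPow_zero_mem_closure {μ : ℝ} (hμ : -(1 / 2) < μ) (hμ' : μ < 1) (t : ℝ≥0)
    (h0 : -(1 / 2) < (0 : ℝ)) :
    logPowLp h0 t ∈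
      (Submodule.span ℝ (Set.range fun v : ℝ≥0 => logPowLp hμ v)).topologicalClosure := by
  set S := (Submodule.span ℝ (Set.range fun v : ℝ≥0 => logPowLp hμ v)).topologicalClosure
  have h1 : -(1 / 2) < (1 : ℝ) := by norm_num
  let ε : ℕ → ℝ := fun m => 1 / ((m : ℝ) + 1)
  have hε : ∀ m, 0 < ε m := fun m => Nat.one_div_pos_of_nat
  have hεlim : Tendsto ε atTop (𝓝 0) := tendsto_one_div_add_atTop_nhds_zero_nat
  have hQ : ∀ m, MemLp (fun x => (ε m)⁻¹ * (logPow 1 (t * Real.exp (ε m)) x - logPow 1 t x))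
      2 volPos := fun m =>
    ((memLp_logPow h1 _).sub (memLp_logPow h1 _)).const_mul _
  have hmem : ∀ m, (hQ m).toLp _ ∈ S := by
    intro m
    have : (hQ m).toLp _ =
        (ε m)⁻¹ • (logPowLp h1 (t * Real.exp (ε m)) - logPowLp h1 t) := by
      rw [logPowLp, logPowLp, ← MemLp.toLp_sub, ← MemLp.toLp_const_smul]
      rfl
    rw [this]
    exact S.smul_mem _ (S.sub_mem (logPow_one_mem_closure hμ hμ' _ h1)
      (logPow_one_mem_closure hμ hμ' _ h1))
  refine (Submodule.isClosed_topologicalClosure _).mem_of_tendsto (b := atTop)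
    (f := fun m => (hQ m).toLp _) ?_ (.of_forall hmem)
  rw [logPowLp, Lp.tendsto_Lp_iff_tendsto_eLpNorm'']
  have hbd : ∀ m, eLpNorm ((fun x => (ε m)⁻¹ * (logPow 1 (t * Real.exp (ε m)) x - logPow 1 t x))
      - logPow 0 t) 2 volPos ≤ ENNReal.ofReal (t * Real.exp (ε m) - t) ^ (1 / 2 : ℝ) := by
    intro m
    calc _ ≤ eLpNorm ((Set.Ico (t : ℝ) (t * Real.exp (ε m))).indicator (fun _ => (1 : ℝ)))
          2 volPos := by
            refine eLpNorm_mono_ae ?_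
            filter_upwards [ae_volPos_pos] with x hx
            exact abs_difference_quotient_sub_logPow_zero_le (hε m) hx
      _ ≤ eLpNorm ((Set.Ico (t : ℝ) (t * Real.exp (ε m))).indicator (fun _ => (1 : ℝ)))
          2 volume := eLpNorm_mono_measure _ Measure.restrict_le_self
      _ = _ := by
        rw [eLpNorm_indicator_const measurableSet_Ico (by simp) (by simp)]
        simp
  have hlim : Tendsto (fun m => ENNReal.ofReal (t * Real.exp (ε m) - t) ^ (1 / 2 : ℝ)) atTop
      (𝓝 0) := by
    have h2 : Tendsto (fun m => t * Real.exp (ε m) - t) atTop (𝓝 (t * Real.exp 0 - t)) :=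
      (((Real.continuous_exp.tendsto 0).comp hεlim).const_mul _).sub_const _
    have h3 := (ENNReal.continuous_rpow_const (y := 1 / 2)).tendsto _ |>.comp
      (ENNReal.tendsto_ofReal h2)
    simpa [Function.comp_def] using h3
  exact tendsto_of_tendsto_of_tendsto_of_le_of_le tendsto_const_nhds hlim (fun _ => zero_le) hbd

/-- The indicator function of `(0, t)` is a limit in `L²(ℝ⁺)` of linear combinations of the
functions `logPow μ v`, `v ≥ 0`. -/
lemma exists_seq_tendsto_logPow_zero {μ : ℝ} (hμ : -(1 / 2) < μ) (hμ' : μ < 1) (t : ℝ≥0) :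
    ∃ (n : ℕ → ℕ) (c : ∀ m, Fin (n m) → ℝ) (v : ∀ m, Fin (n m) → ℝ≥0),
      Tendsto (fun m => eLpNorm
        (fun x => logPow 0 t x - ∑ i, c m i * logPow μ (v m i) x) 2 volPos) atTop (𝓝 0) := by
  have h0 : -(1 / 2) < (0 : ℝ) := by norm_num
  obtain ⟨u, hu, hlim⟩ := mem_closure_iff_seq_limit.1 (logPow_zero_mem_closure hμ hμ' t h0)
  have hu' := fun m => Submodule.mem_span_set'.1 (hu m)
  choose n c w hw using hu'
  choose v hv using fun m i => (w m i).2
  refine ⟨n, c, v, ?_⟩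
  have e : ∀ m, eLpNorm (fun x => logPow 0 t x - ∑ i, c m i * logPow μ (v m i) x) 2 volPos =
      ‖logPowLp h0 t - u m‖ₑ := by
    intro m
    rw [eLpNorm_sub_sum Finset.univ (c m) (fun i => memLp_logPow hμ (v m i)) (memLp_logPow h0 t),
      ← hw m]
    simp_rw [← hv]
    rfl
  simp_rw [e]
  have h3 : Tendsto (fun m => logPowLp h0 t - u m) atTop (𝓝 0) := by
    simpa using hlim.const_sub (logPowLp h0 t)
  simpa [Function.comp_def] using (continuous_enorm.tendsto _).comp h3

/-! ### The Wiener isometry -/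

lemma memLp_ind (t : ℝ≥0) : MemLp (ind t) 2 volPos := by
  refine (memLp_logPow (δ := 0) (by norm_num) t).ae_eq ?_
  filter_upwards [ae_volPos_pos] with x hx using (ind_eq_logPow t hx).symm

/-- Agreement with the Brownian covariance in `integral_brownian_mul_brownian` is the Wiener
isometry on generators. -/
lemma integral_ind_mul_ind (s t : ℝ≥0) :
    ∫ x, ind s x * ind t x ∂volPos = ((min s t : ℝ≥0) : ℝ) := by
  have e : (fun x => ind s x * ind t x) =
      (Set.Ico (0 : ℝ) (min s t : ℝ≥0)).indicator fun _ => 1 := by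
    ext x
    simp only [ind, Set.indicator_apply, Set.mem_Ico, NNReal.coe_min, lt_min_iff]
    split_ifs <;> first | (exfalso; grind) | norm_num
  have h : Set.Ico (0 : ℝ) (min s t : ℝ≥0) ∩ Set.Ioi 0 = Set.Ioo 0 ((min s t : ℝ≥0) : ℝ) := by
    ext x
    simp only [Set.mem_inter_iff, Set.mem_Ico, Set.mem_Ioi, Set.mem_Ioo]
    grind
  rw [e, integral_indicator_const _ measurableSet_Ico, volPos, measureReal_restrict_apply
    measurableSet_Ico, h, Real.volume_real_Ioo_of_le (NNReal.coe_nonneg _), sub_zero, smul_eq_mul,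
    mul_one]

lemma Step.fn_eq (φ : Step) (x : ℝ) :
    φ.fn x = ∑ k, φ.coef k * (ind (φ.right k) x - ind (φ.left k) x) := by
  refine Finset.sum_congr rfl fun k _ => ?_
  congr 1
  have hle : (φ.left k : ℝ) ≤ φ.right k := φ.le k
  have h0 : (0 : ℝ) ≤ φ.left k := (φ.left k).2
  simp only [ind, Set.indicator_apply, Set.mem_Ico]
  split_ifs <;> first | (exfalso; grind) | norm_num

variable {Ω : Type*} [MeasurableSpace Ω] {P : Measure Ω} {B : ℝ≥0 → Ω → ℝ}

lemma memLp_brownian (hB : IsPreBrownianReal B P) (t : ℝ≥0) : MemLp (B t) 2 P :=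
  (hB.isGaussianProcess.hasGaussianLaw_eval t).memLp_two

lemma integral_brownian_mul_brownian [IsProbabilityMeasure P] (hB : IsPreBrownianReal B P)
    (s t : ℝ≥0) : ∫ ω, B s ω * B t ω ∂P = ((min s t : ℝ≥0) : ℝ) := by
  have h := hB.covariance_eval s t
  rw [covariance_eq_sub (memLp_brownian hB s) (memLp_brownian hB t), hB.integral_eval,
    hB.integral_eval, mul_zero, sub_zero] at h
  exact h

/-- The span of the pairs `(1_{[0, t)}, B t)`, the graph of the Wiener integral of step
functions. -/
def wienerGraph (hB : IsPreBrownianReal B P) : Submodule ℝ (Lp ℝ 2 volPos × Lp ℝ 2 P) :=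
  Submodule.span ℝ (Set.range fun t : ℝ≥0 =>
    ((memLp_ind t).toLp (ind t), (memLp_brownian hB t).toLp (B t)))

lemma inner_toLp {X : Type*} [MeasurableSpace X] {μ : Measure X} {f g : X → ℝ}
    (hf : MemLp f 2 μ) (hg : MemLp g 2 μ) :
    inner ℝ (hf.toLp f) (hg.toLp g) = ∫ x, f x * g x ∂μ := by
  rw [L2.inner_def]
  refine integral_congr_ae ?_
  filter_upwards [hf.coeFn_toLp, hg.coeFn_toLp] with x h1 h2
  rw [h1, h2]
  exact mul_comm _ _

lemma inner_eq_of_mem_wienerGraph [IsProbabilityMeasure P] (hB : IsPreBrownianReal B P)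
    {p q : Lp ℝ 2 volPos × Lp ℝ 2 P} (hp : p ∈ wienerGraph hB) (hq : q ∈ wienerGraph hB) :
    inner ℝ p.1 q.1 = inner ℝ p.2 q.2 := by
  induction hp, hq using Submodule.span_induction₂ with
  | mem_mem x y hx hy =>
    obtain ⟨s, rfl⟩ := hx
    obtain ⟨t, rfl⟩ := hy
    simp only
    rw [inner_toLp, inner_toLp, integral_ind_mul_ind, integral_brownian_mul_brownian hB]
  | zero_left y hy => simp
  | zero_right x hx => simp
  | add_left x y z _ _ _ h1 h2 => simp [inner_add_left, h1, h2]
  | add_right x y z _ _ _ h1 h2 => simp [inner_add_right, h1, h2]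
  | smul_left r x y _ _ h => simp [inner_smul_left, h]
  | smul_right r x y _ _ h => simp [inner_smul_right, h]

/-- Equality of the two norms is a closed condition, so the isometry passes from the graph to its
closure without constructing the extended operator. -/
lemma norm_eq_of_mem_closure [IsProbabilityMeasure P] (hB : IsPreBrownianReal B P)
    {p : Lp ℝ 2 volPos × Lp ℝ 2 P} (hp : p ∈ (wienerGraph hB).topologicalClosure) :
    ‖p.1‖ = ‖p.2‖ := by
  have hc : IsClosed {p : Lp ℝ 2 volPos × Lp ℝ 2 P | ‖p.1‖ = ‖p.2‖} :=
    isClosed_eq (by fun_prop) (by fun_prop)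
  refine closure_minimal (fun q hq => ?_) hc hp
  have h := inner_eq_of_mem_wienerGraph hB hq hq
  rw [real_inner_self_eq_norm_sq, real_inner_self_eq_norm_sq] at h
  exact (sq_eq_sq₀ (norm_nonneg _) (norm_nonneg _)).1 h

lemma Step.eLpNorm_sub_fn (φ : Step) {g : ℝ → ℝ} (hg : MemLp g 2 volPos) :
    eLpNorm (fun x => g x - φ.fn x) 2 volPos = ‖hg.toLp g - ∑ k, φ.coef k •
      ((memLp_ind (φ.right k)).toLp _ - (memLp_ind (φ.left k)).toLp _)‖ₑ := by
  simp_rw [φ.fn_eq, ← MemLp.toLp_sub]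
  exact eLpNorm_sub_sum Finset.univ φ.coef
    (fun k => (memLp_ind (φ.right k)).sub (memLp_ind (φ.left k))) hg

lemma Step.eLpNorm_sub_integral (φ : Step) {X : ℝ≥0 → Ω → ℝ} (hX : ∀ t, MemLp (X t) 2 P)
    {Y : Ω → ℝ} (hY : MemLp Y 2 P) :
    eLpNorm (fun ω => Y ω - φ.integral X ω) 2 P = ‖hY.toLp Y - ∑ k, φ.coef k •
      ((hX (φ.right k)).toLp _ - (hX (φ.left k)).toLp _)‖ₑ := by
  simp_rw [← MemLp.toLp_sub]
  exact eLpNorm_sub_sum Finset.univ φ.coef (fun k => (hX (φ.right k)).sub (hX (φ.left k))) hY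

lemma tendsto_of_enorm_sub {E : Type*} [NormedAddCommGroup E] {u : ℕ → E} {a : E}
    (h : Tendsto (fun m => ‖a - u m‖ₑ) atTop (𝓝 0)) : Tendsto u atTop (𝓝 a) := by
  rw [tendsto_iff_edist_tendsto_0]
  simpa only [edist_comm, edist_eq_enorm_sub] using h

lemma IsWienerIntegral.mem_closure (hB : IsPreBrownianReal B P) {g : ℝ → ℝ} {Y : Ω → ℝ}
    (h : IsWienerIntegral P B g Y) :
    (h.memLp_integrand.toLp g, h.memLp.toLp Y) ∈ (wienerGraph hB).topologicalClosure := by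
  obtain ⟨φ, h1, h2⟩ := h.limit
  simp_rw [Step.eLpNorm_sub_fn _ h.memLp_integrand] at h1
  simp_rw [Step.eLpNorm_sub_integral _ (memLp_brownian hB) h.memLp] at h2
  refine mem_closure_of_tendsto
    ((tendsto_of_enorm_sub h1).prodMk_nhds (tendsto_of_enorm_sub h2)) (.of_forall fun m => ?_)
  have e : ∀ t : ℝ≥0, ((memLp_ind t).toLp (ind t), (memLp_brownian hB t).toLp (B t)) ∈
      wienerGraph hB := fun t => Submodule.subset_span ⟨t, rfl⟩
  have := (wienerGraph hB).sum_mem (t := Finset.univ) fun k _ => (wienerGraph hB).smul_mem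
    ((φ m).coef k) ((wienerGraph hB).sub_mem (e ((φ m).right k)) (e ((φ m).left k)))
  change _ ∈ wienerGraph hB
  convert this using 1
  ext1 <;> simp [Prod.fst_sum, Prod.snd_sum]

/-- The difference of the two pairs lies in the closed graph with first component zero, so its
second component has norm zero. -/
lemma IsWienerIntegral.ae_eq [IsProbabilityMeasure P] (hB : IsPreBrownianReal B P) {g : ℝ → ℝ}
    {Y Y' : Ω → ℝ} (h : IsWienerIntegral P B g Y) (h' : IsWienerIntegral P B g Y') :
    Y =ᵐ[P] Y' := by
  have h1 := norm_eq_of_mem_closure hB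
    ((wienerGraph hB).topologicalClosure.sub_mem (h.mem_closure hB) (h'.mem_closure hB))
  simp only [Prod.fst_sub, Prod.snd_sub, sub_self, norm_zero] at h1
  exact (MemLp.toLp_eq_toLp_iff _ _).1 (sub_eq_zero.1 (norm_eq_zero.1 h1.symm))

/-- The Wiener integral of a multiple of `1_{[0, t)}`. -/
lemma isWienerIntegral_const_mul (hB : IsPreBrownianReal B P) {g : ℝ → ℝ} (c : ℝ) (t : ℝ≥0)
    (hg : g =ᵐ[volPos] fun x => c * ind t x) :
    IsWienerIntegral P B g (fun ω => c * B t ω) := by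
  refine ⟨((memLp_ind t).const_mul c).ae_eq hg.symm, (memLp_brownian hB t).const_mul c,
    fun _ => ⟨1, fun _ => c, fun _ => 0, fun _ => t, fun _ => zero_le⟩, ?_, ?_⟩
  · refine tendsto_const_nhds.congr fun _ => ?_
    rw [eq_comm, ← eLpNorm_zero (p := 2) (μ := volPos) (ε := ℝ)]
    refine eLpNorm_congr_ae ?_
    filter_upwards [hg] with x hx
    simp [hx, Step.fn, ind]
  · refine tendsto_const_nhds.congr fun _ => ?_
    rw [eq_comm, ← eLpNorm_zero (p := 2) (μ := P) (ε := ℝ)]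
    refine eLpNorm_congr_ae ?_
    -- The step integral is c (B t - B 0), and B 0 vanishes only almost surely.
    filter_upwards [hB.eval_zero_ae_eq_zero] with ω hω
    simp [Step.integral, hω]

/-- The Wiener isometry for the difference of an integral and a linear combination of increments. -/
lemma eLpNorm_sub_integral_eq [IsProbabilityMeasure P] (hB : IsPreBrownianReal B P)
    {X : ℝ≥0 → Ω → ℝ} {G : ℝ≥0 → ℝ → ℝ} (hX : ∀ t, IsWienerIntegral P B (G t) (X t))
    {g : ℝ → ℝ} {Y : Ω → ℝ} (hY : IsWienerIntegral P B g Y) (φ : Step) :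
    eLpNorm (fun ω => Y ω - φ.integral X ω) 2 P =
      eLpNorm (fun x => g x - ∑ k, φ.coef k * (G (φ.right k) x - G (φ.left k) x)) 2 volPos := by
  rw [φ.eLpNorm_sub_integral (fun t => (hX t).memLp) hY.memLp]
  have e : eLpNorm (fun x => g x - ∑ k, φ.coef k * (G (φ.right k) x - G (φ.left k) x)) 2 volPos =
      ‖hY.memLp_integrand.toLp g - ∑ k, φ.coef k • ((hX (φ.right k)).memLp_integrand.toLp _ -
        (hX (φ.left k)).memLp_integrand.toLp _)‖ₑ := by
    simp_rw [← MemLp.toLp_sub]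
    exact eLpNorm_sub_sum Finset.univ φ.coef (fun k =>
      (hX (φ.right k)).memLp_integrand.sub (hX (φ.left k)).memLp_integrand) hY.memLp_integrand
  refine Eq.trans ?_ e.symm
  set S := (wienerGraph hB).topologicalClosure
  -- The same linear combination is taken in both components, so a single membership in the closed
  -- graph compares the two errors.
  have h := S.sub_mem (hY.mem_closure hB) (S.sum_mem (t := Finset.univ) fun k _ =>
    S.smul_mem (φ.coef k) (S.sub_mem ((hX (φ.right k)).mem_closure hB)
      ((hX (φ.left k)).mem_closure hB)))
  have h1 := norm_eq_of_mem_closure hB h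
  simp only [Prod.fst_sub, Prod.snd_sub, Prod.fst_sum, Prod.snd_sum, Prod.smul_fst,
    Prod.smul_snd] at h1
  rw [← ofReal_norm, ← ofReal_norm, h1]

/-! ### Integrals with respect to the Hadamard fractional Brownian motion -/

lemma ae_volPos_forall_ne {ι : Type*} [Countable ι] (u : ι → ℝ) :
    ∀ᵐ x ∂volPos, ∀ i, x ≠ u i := ae_all_iff.2 fun i => ae_volPos_ne (u i)

lemma ind_ae_eq_logPow (t : ℝ≥0) : ind t =ᵐ[volPos] logPow 0 t := by
  filter_upwards [ae_volPos_pos] with x hx using ind_eq_logPow t hx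

lemma hasFrac_ind {ν x : ℝ} (t : ℝ≥0) (hν : -1 < ν) (hx : 0 < x) (hxt : x ≠ t) :
    HasFrac ν (ind t) x ((Real.Gamma (ν + 1))⁻¹ * logPow ν t x) := by
  have h := hasFrac_logPow (δ := 0) t hν (by norm_num) (by linarith) hx hxt
  simp only [zero_add, Real.Gamma_one, one_div] at h
  exact h.congr_ae hx (ind_ae_eq_logPow t).symm

lemma hasFrac_step {ν x : ℝ} (φ : Step) (hν : -1 < ν) (hx : 0 < x)
    (hl : ∀ k, x ≠ φ.left k) (hr : ∀ k, x ≠ φ.right k) :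
    HasFrac ν φ.fn x (∑ k, φ.coef k * ((Real.Gamma (ν + 1))⁻¹ * logPow ν (φ.right k) x -
      (Real.Gamma (ν + 1))⁻¹ * logPow ν (φ.left k) x)) := by
  rw [funext φ.fn_eq]
  exact HasFrac.sum _ fun k =>
    ((hasFrac_ind _ hν hx (hr k)).sub (hasFrac_ind _ hν hx (hl k))).const_mul _

/-- The order ν cancels the exponent -ν, leaving the indicator of (0, t). -/
lemma hasFrac_of_ae_eq {ν x c : ℝ} {f : ℝ → ℝ} (t : ℝ≥0) (hν : -1 < ν) (hν' : ν < 1)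
    (hf : f =ᵐ[volPos] fun x => c * logPow (-ν) t x) (hx : 0 < x) (hxt : x ≠ t) :
    HasFrac ν f x (c * Real.Gamma (1 - ν) * logPow 0 t x) := by
  have h := (hasFrac_logPow (δ := -ν) t hν (by linarith) (by linarith) hx hxt).const_mul c
  simp only [neg_add_cancel, zero_add, Real.Gamma_one, div_one] at h
  rw [neg_add_eq_sub, ← mul_assoc] at h
  exact h.congr_ae hx hf.symm

section

variable {α c : ℝ} {f : ℝ → ℝ} {t : ℝ≥0}

lemma opM_ind_ae_eq (hα0 : 0 < α) (hα1 : α ≠ 1) (t : ℝ≥0) :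
    opM α (ind t) =ᵐ[volPos]
      fun x => constK α * ((Real.Gamma ((α - 1) / 2 + 1))⁻¹ * logPow ((α - 1) / 2) t x) := by
  filter_upwards [ae_volPos_pos, ae_volPos_ne t] with x hx hxt
  exact (hasFrac_opM (hasFrac_ind t (by linarith) hx hxt) hα1).2

lemma opMExists_of_ae_eq (hα0 : 0 < α) (hα1 : α ≠ 1) (hα2 : α < 2)
    (hf : f =ᵐ[volPos] fun x => c * logPow (-((α - 1) / 2)) t x) : OpMExists α f := by
  filter_upwards [ae_volPos_pos, ae_volPos_ne t] with x hx hxt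
  exact (hasFrac_opM (hasFrac_of_ae_eq t (by linarith) (by linarith) hf hx hxt) hα1).1

lemma opM_ae_eq (hα0 : 0 < α) (hα1 : α ≠ 1) (hα2 : α < 2)
    (hf : f =ᵐ[volPos] fun x => c * logPow (-((α - 1) / 2)) t x) :
    opM α f =ᵐ[volPos]
      fun x => constK α * (c * Real.Gamma (1 - (α - 1) / 2)) * ind t x := by
  filter_upwards [ae_volPos_pos, ae_volPos_ne t] with x hx hxt
  rw [(hasFrac_opM (hasFrac_of_ae_eq t (by linarith) (by linarith) hf hx hxt) hα1).2,
    ind_eq_logPow t hx]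
  ring

/-- Linearity of M^α needs the derivatives involved to exist; they do away from t and the finitely
many endpoints of the steps. -/
lemma opM_sub_step_ae_eq (hα0 : 0 < α) (hα1 : α ≠ 1) (hα2 : α < 2)
    (hf : f =ᵐ[volPos] fun x => c * logPow (-((α - 1) / 2)) t x) (φ : Step) :
    opM α (fun x => f x - φ.fn x) =ᵐ[volPos] fun x => opM α f x -
      ∑ k, φ.coef k * (opM α (ind (φ.right k)) x - opM α (ind (φ.left k)) x) := by
  filter_upwards [ae_volPos_pos, ae_volPos_ne t, ae_volPos_forall_ne fun k => (φ.left k : ℝ),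
    ae_volPos_forall_ne fun k => (φ.right k : ℝ)] with x hx hxt hl hr
  have h1 := hasFrac_of_ae_eq t (by linarith) (by linarith) hf hx hxt
  have h2 : -1 < (α - 1) / 2 := by linarith
  rw [(hasFrac_opM (h1.sub (hasFrac_step φ h2 hx hl hr)) hα1).2, (hasFrac_opM h1 hα1).2, mul_sub,
    Finset.mul_sum]
  congr 1
  refine Finset.sum_congr rfl fun k _ => ?_
  rw [(hasFrac_opM (hasFrac_ind _ h2 hx (hr k)) hα1).2,
    (hasFrac_opM (hasFrac_ind _ h2 hx (hl k)) hα1).2]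
  ring

lemma exists_stepTendsto (hα0 : 0 < α) (hα1 : α ≠ 1) (hα2 : α < 2)
    (hf : f =ᵐ[volPos] fun x => c * logPow (-((α - 1) / 2)) t x) :
    ∃ φ : ℕ → Step, StepTendsto α φ f := by
  obtain ⟨n, a, v, h⟩ := exists_seq_tendsto_logPow_zero (μ := (α - 1) / 2) (by linarith)
    (by linarith) t
  have hΓ : Real.Gamma ((α - 1) / 2 + 1) ≠ 0 := (Real.Gamma_pos_of_pos (by linarith)).ne'
  set D := c * Real.Gamma (1 - (α - 1) / 2)
  -- M^α f is `constK α * D` times the indicator, and M^α of 1_{[0,v)} carries the factor 1/Γ(μ+1);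
  -- these coefficients compensate both, so the error is the L² error of the approximants times a
  -- constant.
  refine ⟨fun m => ⟨n m, fun i => D * Real.Gamma ((α - 1) / 2 + 1) * a m i, fun _ => 0, v m,
    fun _ => zero_le⟩, ?_⟩
  have e : ∀ m, eLpNorm (opM α fun x => f x - Step.fn ⟨n m,
      fun i => D * Real.Gamma ((α - 1) / 2 + 1) * a m i, fun _ => 0, v m, fun _ => zero_le⟩ x)
      2 volPos = ‖constK α * D‖ₑ * eLpNorm
        (fun x => logPow 0 t x - ∑ i, a m i * logPow ((α - 1) / 2) (v m i) x) 2 volPos := by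
    intro m
    rw [← eLpNorm_const_smul]
    refine eLpNorm_congr_ae ((opM_sub_step_ae_eq hα0 hα1 hα2 hf _).trans ?_)
    have hv : ∀ᵐ x ∂volPos, ∀ i, opM α (ind (v m i)) x = constK α *
        ((Real.Gamma ((α - 1) / 2 + 1))⁻¹ * logPow ((α - 1) / 2) (v m i) x) :=
      ae_all_iff.2 fun i => opM_ind_ae_eq hα0 hα1 (v m i)
    filter_upwards [ae_volPos_pos, opM_ae_eq hα0 hα1 hα2 hf, hv, opM_ind_ae_eq hα0 hα1 0]
      with x hx h1 h2 h3
    rw [h1, ind_eq_logPow t hx]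
    simp only [Pi.smul_apply, smul_eq_mul]
    rw [mul_sub, Finset.mul_sum]
    congr 1
    refine Finset.sum_congr rfl fun i _ => ?_
    -- The left endpoints are 0 and contribute nothing.
    have h4 : logPow ((α - 1) / 2) (0 : ℝ≥0) x = 0 := logPow_of_le (by simpa using hx.le)
    rw [h2 i, h3, h4]
    linear_combination (constK α * D * a m i * logPow ((α - 1) / 2) (v m i) x) *
      mul_inv_cancel₀ hΓ
  unfold StepTendsto
  simp_rw [e]
  simpa only [mul_zero] using
    ENNReal.Tendsto.const_mul h (Or.inr (enorm_ne_top (x := constK α * D)))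

variable {Ω : Type*} [MeasurableSpace Ω] {P : Measure Ω} {B BH : ℝ≥0 → Ω → ℝ}

/-- The integral of a multiple of `log (t / ·) ^ ((1 - α) / 2) 1_{(0, t)}` with respect to the
Hadamard fractional Brownian motion is a multiple of `B t`. -/
lemma isHadamardIntegral_brownian [IsProbabilityMeasure P] (hα0 : 0 < α) (hα1 : α ≠ 1)
    (hα2 : α < 2) (hB : IsPreBrownianReal B P) (hBH : IsHadamardFBM α P B BH)
    (hf : f =ᵐ[volPos] fun x => c * logPow (-((α - 1) / 2)) t x) :
    IsHadamardIntegral α P B BH f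
      (fun ω => constK α * (c * Real.Gamma (1 - (α - 1) / 2)) * B t ω) := by
  have hW := isWienerIntegral_const_mul hB _ t (opM_ae_eq hα0 hα1 hα2 hf)
  refine ⟨⟨opMExists_of_ae_eq hα0 hα1 hα2 hf, hW.memLp_integrand⟩, hW,
    exists_stepTendsto hα0 hα1 hα2 hf, fun φ hφ => hφ.congr fun m => ?_⟩
  rw [eLpNorm_sub_integral_eq hB hBH hW (φ m),
    eLpNorm_congr_ae (opM_sub_step_ae_eq hα0 hα1 hα2 hf (φ m))]

/-- Almost sure uniqueness of Wiener integrals identifies every version with the explicit multiple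
of B t; d inverts that multiple. -/
lemma exists_isHadamardIntegral_and_forall_ae_eq [IsProbabilityMeasure P] (hα0 : 0 < α)
    (hα1 : α ≠ 1) (hα2 : α < 2) (hB : IsPreBrownianReal B P) (hBH : IsHadamardFBM α P B BH)
    (hf : f =ᵐ[volPos] fun x => c * logPow (-((α - 1) / 2)) t x) {d : ℝ}
    (hd : d * (constK α * (c * Real.Gamma (1 - (α - 1) / 2))) = 1) :
    (∃ Y : Ω → ℝ, IsHadamardIntegral α P B BH f Y) ∧
      ∀ Y : Ω → ℝ, IsHadamardIntegral α P B BH f Y → B t =ᵐ[P] fun ω => d * Y ω := by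
  have h := isHadamardIntegral_brownian hα0 hα1 hα2 hB hBH hf
  refine ⟨⟨_, h⟩, fun Y hY => ?_⟩
  filter_upwards [h.wiener.ae_eq hB hY.wiener] with ω hω
  rw [← hω, ← mul_assoc, hd, one_mul]

end

end

end HadamardFBM

/-! ### The two representations of Brownian motion -/

theorem theorem7p5 {Ω : Type*} [MeasurableSpace Ω] (P : Measure Ω) [IsProbabilityMeasure P]
    (α : ℝ) (hα : α ∈ Set.Ioo (0 : ℝ) 1 ∪ Set.Ioo (1 : ℝ) 2)
    (B BH : ℝ≥0 → Ω → ℝ) (hB : IsPreBrownianReal B P)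
    (hBH : HadamardFBM.IsHadamardFBM α P B BH) (t : ℝ≥0) :
    -- the inverse operator applied to the indicator of `[0, t)` is defined and lies in `L²(ℝ⁺)`
    (HadamardFBM.OpMBarExists α (HadamardFBM.ind t) ∧
      MemLp (HadamardFBM.opMBar α (HadamardFBM.ind t)) 2 HadamardFBM.volPos) ∧
    -- its integral with respect to `BH` exists, and `C'_α` times it is `B t`
    ((∃ Y : Ω → ℝ, HadamardFBM.IsHadamardIntegral α P B BH
        (HadamardFBM.opMBar α (HadamardFBM.ind t)) Y) ∧
      ∀ Y : Ω → ℝ, HadamardFBM.IsHadamardIntegral α P B BH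
        (HadamardFBM.opMBar α (HadamardFBM.ind t)) Y →
        B t =ᵐ[P] fun ω => √(Real.Gamma α) / Real.Gamma ((α + 1) / 2) * Y ω) ∧
    -- the explicit form
    ((∃ Y : Ω → ℝ, HadamardFBM.IsHadamardIntegral α P B BH
        ((Set.Ico (0 : ℝ) t).indicator (fun s => Real.log (t / s) ^ ((1 - α) / 2))) Y) ∧
      ∀ Y : Ω → ℝ, HadamardFBM.IsHadamardIntegral α P B BH
        ((Set.Ico (0 : ℝ) t).indicator (fun s => Real.log (t / s) ^ ((1 - α) / 2))) Y →
        B t =ᵐ[P] fun ω => √(Real.Gamma α) /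
          (Real.Gamma ((α + 1) / 2) * Real.Gamma ((3 - α) / 2)) * Y ω) := by
  open HadamardFBM in
  obtain ⟨hα0, hα1, hα2⟩ : 0 < α ∧ α ≠ 1 ∧ α < 2 := by
    rcases hα with h | h
    · exact ⟨h.1, h.2.ne, h.2.trans one_lt_two⟩
    · exact ⟨one_pos.trans h.1, h.1.ne', h.2⟩
  have eμ : (1 - α) / 2 = -((α - 1) / 2) := by ring
  have hΓ3 : 0 < Real.Gamma ((3 - α) / 2) := Real.Gamma_pos_of_pos (by linarith)
  have hΓ1 : 0 < Real.Gamma ((α + 1) / 2) := Real.Gamma_pos_of_pos (by linarith)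
  have hΓα : 0 < √(Real.Gamma α) := Real.sqrt_pos.2 (Real.Gamma_pos_of_pos hα0)
  have e1 : 1 - (α - 1) / 2 = (3 - α) / 2 := by ring
  have hbar : ∀ᵐ x ∂volPos, ((α < 1 → HadamardIntExists ((1 - α) / 2) (ind t) x) ∧
      (1 < α → HadamardDerivExists ((α - 1) / 2) (ind t) x)) ∧
      opMBar α (ind t) x =
        (Real.Gamma ((3 - α) / 2))⁻¹ * logPow (-((α - 1) / 2)) t x := by
    filter_upwards [ae_volPos_pos, ae_volPos_ne t] with x hx hxt
    rw [← eμ]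
    have h := hasFrac_opMBar (hasFrac_ind (ν := (1 - α) / 2) t (by linarith) hx hxt) hα1
    rwa [show (1 - α) / 2 + 1 = (3 - α) / 2 by ring] at h
  have hbar' : opMBar α (ind t) =ᵐ[volPos] fun x =>
      (Real.Gamma ((3 - α) / 2))⁻¹ * logPow (-((α - 1) / 2)) t x := hbar.mono fun x hx => hx.2
  have hexp : (Set.Ico (0 : ℝ) t).indicator (fun s => Real.log (t / s) ^ ((1 - α) / 2))
      =ᵐ[volPos] fun x => 1 * logPow (-((α - 1) / 2)) t x := by
    filter_upwards [ae_volPos_pos] with x hx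
    rw [one_mul, ← eμ]
    by_cases h : x < t
    · rw [logPow_of_mem hx h, Set.indicator_of_mem (show x ∈ Set.Ico (0 : ℝ) t from ⟨hx.le, h⟩)]
    · rw [logPow_of_le (not_lt.1 h), Set.indicator_of_notMem (fun h' => h h'.2)]
  refine ⟨⟨hbar.mono fun x hx => hx.1,
    ((memLp_logPow (by linarith) t).const_mul _).ae_eq hbar'.symm⟩,
    exists_isHadamardIntegral_and_forall_ae_eq hα0 hα1 hα2 hB hBH hbar' ?_,
    exists_isHadamardIntegral_and_forall_ae_eq hα0 hα1 hα2 hB hBH hexp ?_⟩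
  -- Here c = 1/Γ((3-α)/2) cancels the Gamma factor produced by M^α, so d is 1/K_α.
  · rw [e1, constK]
    field_simp
  -- Here c = 1, so Γ((3-α)/2) survives and appears in the denominator of d.
  · rw [e1, constK]
    field_simp
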